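/- Let $n\ge 1$. A \emph{strongly pseudoconvex real analytic real hypersurface} in $\mathbb{C}^{n+1}$ is a set $M\subset\mathbb{C}^{n+1}$ such that every $z\in M$ has an open neighborhood $V$ carrying a real analytic function $\rho:V\to\mathbb{R}$ with $d\rho\neq 0$ on $V$, $M\cap V=\{\rho=0\}$, and $$\sum_{j,k}\frac{\partial^2\rho}{\partial z_j\,\partial\overline{z}_k}(z)\,v_j\overline{v}_k>0\quad\text{for all } v\in\mathbb{C}^{n+1}\setminus\{0\}\text{ with }\sum_j\frac{\partial\rho}{\partial z_j}(z)\,v_j=0 .$$ Let $M,M'$ be strongly pseudoconvex real analytic real hypersurfaces in $\mathbb{C}^{n+1}$, let $U$ be an open neighborhood of a point $p\in M$, and let $\phi:U\to\mathbb{C}^{n+1}$ be a holomorphic mapping such that $$\phi(U\cap M)\subset M'.$$ Then, after shrinking $U$ if necessary, $\phi$ is either constant or biholomorphic on $U$; that is, there is an open neighborhood $V\subset U$ of $p$ such that either $\phi$ is constant on $V$, or $\phi$ maps $V$ biholomorphically onto an open subset of $\mathbb{C}^{n+1}$. -/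

import Mathlib

/-- The complex Euclidean space of `m` complex dimensions. -/
abbrev ComplexSpace (m : ℕ) : Type := EuclideanSpace ℂ (Fin m)

/-- `ρ` is a real analytic local defining function on the open set `V` for the set `M`:
it is real analytic on `V`, its real differential vanishes nowhere on `V`, and inside `V` the
set `M` is exactly the zero set of `ρ`. -/
structure IsAnalyticDefiningFunction {m : ℕ} (M V : Set (ComplexSpace m))
    (ρ : ComplexSpace m → ℝ) : Prop where
  isOpen : IsOpen V
  analytic : AnalyticOnNhd ℝ ρ V
  fderiv_ne_zero : ∀ z ∈ V, fderiv ℝ ρ z ≠ 0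
  inter_eq : M ∩ V = {z ∈ V | ρ z = 0}

/-- The complex tangent space at `z` of the level set of `ρ` through `z`: the vectors `v` with
`∑ j, (∂ρ/∂z_j)(z) v_j = 0`, that is, those `v` for which both `v` and `i v` are annihilated by the
real differential of `ρ` at `z`. -/
def complexTangentSpace {m : ℕ} (ρ : ComplexSpace m → ℝ) (z : ComplexSpace m) :
    Set (ComplexSpace m) :=
  {v | fderiv ℝ ρ z v = 0 ∧ fderiv ℝ ρ z (Complex.I • v) = 0}

/-- The Levi form of `ρ` at `z` in the direction `v`,
`∑ j k, (∂²ρ/∂z_j ∂z̄_k)(z) v_j v̄_k = (D²ρ(z)(v, v) + D²ρ(z)(i v, i v)) / 4`,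
where `D²ρ(z)` is the second real derivative of `ρ` at `z`. -/
noncomputable def leviForm {m : ℕ} (ρ : ComplexSpace m → ℝ) (z v : ComplexSpace m) : ℝ :=
  (fderiv ℝ (fderiv ℝ ρ) z v v
    + fderiv ℝ (fderiv ℝ ρ) z (Complex.I • v) (Complex.I • v)) / 4

/-- `M` is a strongly pseudoconvex real analytic (embedded, not necessarily closed) real
hypersurface: near each of its points `z` it has a real analytic local defining function whose
Levi form at `z` is positive definite on the complex tangent space at `z`. Since `ρ` may be
replaced by `-ρ`, no side of `M` is singled out beforehand. -/
def IsStronglyPseudoconvexAnalyticHypersurface {m : ℕ} (M : Set (ComplexSpace m)) : Prop :=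
  ∀ z ∈ M, ∃ (V : Set (ComplexSpace m)) (ρ : ComplexSpace m → ℝ),
    z ∈ V ∧ IsAnalyticDefiningFunction M V ρ ∧
      ∀ v ∈ complexTangentSpace ρ z, v ≠ 0 → 0 < leviForm ρ z v

/-- `φ` is a biholomorphic mapping of the open set `V` onto its image: the image is open, `φ` is
holomorphic and injective on `V`, and the inverse mapping is holomorphic on the image. -/
structure IsBiholomorphicOn {m : ℕ} (φ : ComplexSpace m → ComplexSpace m)
    (V : Set (ComplexSpace m)) : Prop where
  isOpen : IsOpen V
  isOpen_image : IsOpen (φ '' V)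
  holomorphic : AnalyticOnNhd ℂ φ V
  injOn : Set.InjOn φ V
  exists_inverse : ∃ ψ : ComplexSpace m → ComplexSpace m,
    AnalyticOnNhd ℂ ψ (φ '' V) ∧ ∀ z ∈ V, ψ (φ z) = z

open Filter Topology Asymptotics

/-! Choose strictly plurisubharmonic defining functions `ρ` of `M` near `p` and `ρ'` of `M'` near `φ
p`, and study `u = ρ' ∘ φ`. It is real analytic, vanishes on `M`, and is plurisubharmonic because
its Levi form is that of `ρ'` pulled back by the complex differential of `φ` (`leviForm_comp`).

The zeros on `M` control `u` on the pseudoconvex side: the level sets of the Levi polynomial supply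
complex directions for a maximum principle on `{ρ ≤ 0}`, which gives `u ≤ 0` there
(`eventually_nonpos_of_eq_zero_on_hypersurface`). In an interior ball touching `M` at `p`, either
`u` is negative and the Hopf lemma gives `du(p) ≠ 0`, or `u` has an interior zero and the strong
maximum principle with analyticity gives `u = 0` near `p`.

If `u = 0`, the Levi form of `ρ'` vanishes on the range of `dφ`; strict positivity forces `dφ = 0`,
so `φ` is constant. If `du(p) ≠ 0`, then `du(p) = a dρ(p)` with `a ≠ 0`, and the second derivatives
have the same ratio on tangent vectors (`exists_jet_proportional`). A kernel vector of `dφ(p)` is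
then tangent to `M` and null for the Levi form of `ρ`, hence zero, and the inverse function theorem
applies. -/

theorem tendsto_const_add_nhds_zero {E : Type*} [AddZeroClass E] [TopologicalSpace E]
    [ContinuousAdd E] (p : E) : Tendsto (fun x : E => p + x) (𝓝 0) (𝓝 p) :=
  (continuous_const.add continuous_id).tendsto' 0 p (by simp)

/-! ### Second order Taylor expansions -/

/-- Second order Taylor expansion with Peano remainder. -/
theorem taylor_two_isLittleO {𝕜 E F : Type*} [RCLike 𝕜] [NormedAddCommGroup E] [NormedSpace 𝕜 E]
    [NormedAddCommGroup F] [NormedSpace 𝕜 F] {f : E → F} {p : E} (hf : ContDiffAt 𝕜 2 f p) :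
    (fun x : E => f (p + x) - f p - fderiv 𝕜 f p x - (1 / 2 : 𝕜) • fderiv 𝕜 (fderiv 𝕜 f) p x x)
      =o[𝓝 0] fun x => ‖x‖ ^ 2 := by
  let _ : NormedSpace ℝ E := NormedSpace.restrictScalars ℝ 𝕜 E
  have hsymm : IsSymmSndFDerivAt 𝕜 f p := hf.isSymmSndFDerivAt (by simp)
  have hdf : ∀ᶠ y in 𝓝 p, DifferentiableAt 𝕜 f y := by
    filter_upwards [hf.eventually (by simp)] with y hy using hy.differentiableAt (by simp)
  have hd2 : HasFDerivAt (fderiv 𝕜 f) (fderiv 𝕜 (fderiv 𝕜 f) p) p :=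
    ((hf.fderiv_right (m := 1) (by norm_num)).differentiableAt (by simp)).hasFDerivAt
  rw [hasFDerivAt_iff_isLittleO_nhds_zero] at hd2
  rw [isLittleO_iff]
  intro c hc
  have h1 := (isLittleO_iff.1 hd2 hc).and ((tendsto_const_add_nhds_zero p).eventually hdf)
  obtain ⟨δ, hδ, hball⟩ := Metric.eventually_nhds_iff_ball.1 h1
  filter_upwards [Metric.ball_mem_nhds (0 : E) hδ] with x hx
  set D := fderiv 𝕜 (fderiv 𝕜 f) p with hD
  have hmem : ∀ y ∈ Metric.closedBall (0 : E) ‖x‖, y ∈ Metric.ball (0 : E) δ := by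
    intro y hy
    simp only [Metric.mem_closedBall, dist_zero_right, Metric.mem_ball] at hy hx ⊢
    exact hy.trans_lt hx
  have hder : ∀ y ∈ Metric.closedBall (0 : E) ‖x‖, HasFDerivWithinAt
      (fun y => f (p + y) - f p - fderiv 𝕜 f p y - (1 / 2 : 𝕜) • D y y)
      (fderiv 𝕜 f (p + y) - fderiv 𝕜 f p - D y) (Metric.closedBall (0 : E) ‖x‖) y := by
    intro y hy
    have h2 : HasFDerivAt (fun y => f (p + y)) (fderiv 𝕜 f (p + y)) y := by
      have := (hball y (hmem y hy)).2.hasFDerivAt.comp y ((hasFDerivAt_id y).const_add p)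
      rwa [ContinuousLinearMap.comp_id] at this
    have h3 : HasFDerivAt (fun y => D y y) (D y + D.flip y) y :=
      D.hasFDerivAt.clm_apply (hasFDerivAt_id (𝕜 := 𝕜) y)
    -- Symmetry of the second derivative makes the quadratic term differentiate to `D y`, so the
    -- derivative of the remainder is `o(‖y‖)` and the mean value inequality gains one order.
    have h4 : (1 / 2 : 𝕜) • (D y + D.flip y) = D y := by
      ext z
      have : D z y = D y z := hsymm z y
      simp [this, ← two_smul 𝕜]
    have := ((h2.sub_const (f p)).sub (fderiv 𝕜 f p).hasFDerivAt).sub (h3.const_smul (1 / 2 : 𝕜))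
    rw [h4] at this
    exact this.hasFDerivWithinAt
  have := (convex_closedBall (0 : E) ‖x‖).norm_image_sub_le_of_norm_hasFDerivWithin_le hder
    (C := c * ‖x‖) (fun y hy => ?_) (x := 0) (y := x) (by simp) (by simp)
  · simpa [sq, mul_assoc] using this
  · refine (hball y (hmem y hy)).1.trans ?_
    gcongr
    simpa using hy

/-- Second order expansion of a `C²` function along a family `x = a + b + o(g²)` with `a = O(g)` and
`b = O(g²)`. -/
theorem ContDiffAt.isLittleO_comp_expansion {E F α : Type*} [NormedAddCommGroup E] [NormedSpace ℝ E]
    [NormedAddCommGroup F] [NormedSpace ℝ F] {f : E → F} {q : E} (hf : ContDiffAt ℝ 2 f q)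
    {l : Filter α} {g : α → ℝ} (hg : Tendsto g l (𝓝 0)) {x a b : α → E}
    (ha : a =O[l] g) (hb : b =O[l] fun t => g t ^ 2)
    (hx : (fun t => x t - a t - b t) =o[l] fun t => g t ^ 2) :
    (fun t => f (q + x t) - f q - fderiv ℝ f q (a t) - fderiv ℝ f q (b t)
      - (1 / 2 : ℝ) • fderiv ℝ (fderiv ℝ f) q (a t) (a t)) =o[l] fun t => g t ^ 2 := by
  set D := fderiv ℝ f q
  set H := fderiv ℝ (fderiv ℝ f) q
  have hgg : (fun t => g t ^ 2) =o[l] g := by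
    simpa [sq] using (isLittleO_one_iff ℝ |>.2 hg).mul_isBigO (isBigO_refl g l)
  have hxa : (fun t => x t - a t) =O[l] fun t => g t ^ 2 := by
    simpa using hx.isBigO.add hb
  have hxg : x =O[l] g := by
    simpa using (hxa.trans_isLittleO hgg).isBigO.add ha
  have hx0 : Tendsto x l (𝓝 0) := hxg.trans_tendsto hg
  have h1 : (fun t => f (q + x t) - f q - D (x t) - (1 / 2 : ℝ) • H (x t) (x t))
      =o[l] fun t => g t ^ 2 :=
    ((taylor_two_isLittleO hf).comp_tendsto hx0).trans_isBigO (hxg.norm_left.pow 2)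
  have h2 : (fun t => D (x t - a t - b t)) =o[l] fun t => g t ^ 2 :=
    (D.isBigO_comp _ _).trans_isLittleO hx
  have h3 : ∀ u v : α → E, u =O[l] (fun t => g t ^ 2) → v =O[l] g →
      (fun t => H (u t) (v t)) =o[l] fun t => g t ^ 2 := by
    intro u v hu hv
    have : (fun t => H (u t) (v t)) =O[l] fun t => ‖u t‖ * ‖v t‖ :=
      IsBigO.of_bound ‖H‖ (Eventually.of_forall fun t => by
        simpa [mul_assoc] using H.le_opNorm₂ (u t) (v t))
    refine this.trans_isLittleO ?_
    refine (hu.norm_left.mul hv.norm_left).trans_isLittleO ?_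
    simpa using (isBigO_refl (fun t => g t ^ 2) l).mul_isLittleO (isLittleO_one_iff ℝ |>.2 hg)
  have h3' : ∀ u v : α → E, u =O[l] g → v =O[l] (fun t => g t ^ 2) →
      (fun t => H (u t) (v t)) =o[l] fun t => g t ^ 2 := by
    intro u v hu hv
    have : (fun t => H (u t) (v t)) =O[l] fun t => ‖u t‖ * ‖v t‖ :=
      IsBigO.of_bound ‖H‖ (Eventually.of_forall fun t => by
        simpa [mul_assoc] using H.le_opNorm₂ (u t) (v t))
    refine this.trans_isLittleO ?_
    refine (hu.norm_left.mul hv.norm_left).trans_isLittleO ?_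
    simpa using (isLittleO_one_iff ℝ |>.2 hg).mul_isBigO (isBigO_refl (fun t => g t ^ 2) l)
  have h4 := ((h3 _ _ hxa hxg).const_smul_left (1 / 2 : ℝ)).add
    ((h3' _ _ ha hxa).const_smul_left (1 / 2 : ℝ))
  refine ((h1.add h2).add h4).congr_left fun t => ?_
  simp only [map_sub, sub_apply, Pi.smul_apply, smul_sub]
  abel

/-! ### Levi forms from four-point sums -/

/-- `L` is the Levi form of `f` at `y` in the direction `ξ`, in the weak sense that it is the
coefficient in the expansion of the sum of `f` over the four points `y ± s ξ`, `y ± i s ξ`. -/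
def HasLeviAt {E : Type*} [NormedAddCommGroup E] [NormedSpace ℂ E] (f : E → ℝ) (y ξ : E)
    (L : ℝ) : Prop :=
  (fun s : ℝ => f (y + (s : ℂ) • ξ) + f (y + (-s : ℂ) • ξ) + f (y + (Complex.I * s : ℂ) • ξ)
    + f (y + (-(Complex.I * s) : ℂ) • ξ) - 4 * f y - 4 * s ^ 2 * L) =o[𝓝 0] fun s : ℝ => s ^ 2

namespace HasLeviAt

variable {E : Type*} [NormedAddCommGroup E] [NormedSpace ℂ E] {f g : E → ℝ} {y ξ : E} {L L' : ℝ}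

theorem add (hf : HasLeviAt f y ξ L) (hg : HasLeviAt g y ξ L') :
    HasLeviAt (fun z => f z + g z) y ξ (L + L') :=
  (IsLittleO.add hf hg).congr_left fun s => by ring

theorem const_mul (c : ℝ) (hf : HasLeviAt f y ξ L) : HasLeviAt (fun z => c * f z) y ξ (c * L) :=
  (IsLittleO.const_mul_left hf c).congr_left fun s => by ring

theorem nonpos_of_isLocalMax (hf : HasLeviAt f y ξ L) (hmax : IsLocalMax f y) : L ≤ 0 := by
  by_contra! hL
  have key : ∀ c : ℂ, ∀ᶠ s : ℝ in 𝓝 0, f (y + (c * s) • ξ) ≤ f y := fun c => by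
    have : Tendsto (fun s : ℝ => y + (c * s) • ξ) (𝓝 0) (𝓝 y) :=
      Continuous.tendsto' (by fun_prop) _ _ (by simp)
    exact this.eventually hmax
  have h := (isLittleO_iff.1 hf hL)
  have h5 : ∀ᶠ s : ℝ in 𝓝[≠] 0, False := by
    filter_upwards [nhdsWithin_le_nhds (key 1), nhdsWithin_le_nhds (key (-1)),
      nhdsWithin_le_nhds (key Complex.I), nhdsWithin_le_nhds (key (-Complex.I)),
      nhdsWithin_le_nhds h, self_mem_nhdsWithin] with s h1 h2 h3 h4 h hs
    simp only [one_mul, neg_mul] at h1 h2 h3 h4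
    have hs2 : 0 < s ^ 2 := by positivity [show s ≠ 0 from hs]
    rw [Real.norm_eq_abs, Real.norm_eq_abs, abs_of_pos hs2] at h
    have := (abs_le.1 h).1
    nlinarith
  exact h5.exists.elim fun _ h => h

theorem unique (hf : HasLeviAt f y ξ L) (hf' : HasLeviAt f y ξ L') : L = L' := by
  have h : (fun s : ℝ => 4 * (L' - L) * s ^ 2) =o[𝓝 0] fun s : ℝ => s ^ 2 :=
    (IsLittleO.sub hf hf').congr_left fun s => by ring
  by_contra hne
  have hc : (4 * (L' - L)) ≠ 0 := by
    intro h0; apply hne; linarith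
  have h2 := (isLittleO_const_mul_left_iff hc).1 h
  refine isLittleO_irrefl ?_ h2
  have h3 : ∀ᶠ s : ℝ in 𝓝[≠] 0, s ^ 2 ≠ 0 := by
    filter_upwards [self_mem_nhdsWithin] with s hs using pow_ne_zero 2 hs
  exact h3.frequently.filter_mono nhdsWithin_le_nhds

end HasLeviAt

variable {m k : ℕ}

/-- The Levi form of the composition of a `C²` function with a holomorphic mapping. -/
theorem hasLeviAt_comp {f : ComplexSpace k → ℝ} {φ : ComplexSpace m → ComplexSpace k}
    {y : ComplexSpace m} (hφ : AnalyticAt ℂ φ y) (hf : ContDiffAt ℝ 2 f (φ y))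
    (ξ : ComplexSpace m) :
    HasLeviAt (fun z => f (φ z)) y ξ (leviForm f (φ y) (fderiv ℂ φ y ξ)) := by
  set w := fderiv ℂ φ y ξ
  set h := (1 / 2 : ℂ) • fderiv ℂ (fderiv ℂ φ) y ξ ξ
  have hT := taylor_two_isLittleO (hφ.contDiffAt (n := 2))
  have key : ∀ c : ℂ, (fun s : ℝ => f (φ (y + (c * s) • ξ)) - f (φ y)
      - s * fderiv ℝ f (φ y) (c • w) - s ^ 2 * fderiv ℝ f (φ y) (c ^ 2 • h)
      - (1 / 2 : ℝ) * (s ^ 2 * fderiv ℝ (fderiv ℝ f) (φ y) (c • w) (c • w)))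
      =o[𝓝 0] fun s : ℝ => s ^ 2 := by
    intro c
    have ht : Tendsto (fun s : ℝ => (c * s) • ξ) (𝓝 0) (𝓝 0) :=
      Continuous.tendsto' (by fun_prop) _ _ (by simp)
    have hO : (fun s : ℝ => (c * s) • ξ) =O[𝓝 0] fun s : ℝ => s :=
      IsBigO.of_bound (‖c‖ * ‖ξ‖) (Eventually.of_forall fun s => by
        simp [norm_smul]; apply le_of_eq; ring)
    have hx := (hT.comp_tendsto ht).trans_isBigO (hO.norm_left.pow 2)
    have := hf.isLittleO_comp_expansion (l := 𝓝 (0 : ℝ)) (g := fun s => s) tendsto_id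
      (x := fun s => φ (y + (c * s) • ξ) - φ y) (a := fun s => s • (c • w))
      (b := fun s => (s ^ 2) • (c ^ 2 • h))
      (IsBigO.of_bound ‖c • w‖ (Eventually.of_forall fun s => by
        rw [norm_smul, mul_comm]))
      (IsBigO.of_bound ‖c ^ 2 • h‖ (Eventually.of_forall fun s => by
        rw [norm_smul, mul_comm]))
      (hx.congr_left fun s => by
        simp only [Function.comp, map_smul, smul_apply, w, h]
        simp only [← Complex.coe_smul, smul_smul]
        congr 1
        · congr 1
          ring_nf
        · congr 1
          push_cast
          ring)
    refine this.congr_left fun s => ?_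
    simp only [add_sub_cancel, map_smul, smul_apply, smul_eq_mul]
    ring
  have h1 := key 1
  have h2 := key (-1)
  have h3 := key Complex.I
  have h4 := key (-Complex.I)
  -- Over `c = 1, -1, I, -I` both `c` and `c ^ 2` sum to zero: the first order terms and the second
  -- derivative `h` of `φ` cancel, and only the Hessian of `f` remains.
  refine (((h1.add h2).add h3).add h4).congr_left fun s => ?_
  simp only [leviForm, neg_smul, one_smul, one_mul, neg_mul, map_neg, neg_apply,
    neg_sq, Complex.I_sq, one_pow]
  ring

theorem hasLeviAt_leviForm {f : ComplexSpace m → ℝ} {y : ComplexSpace m}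
    (hf : ContDiffAt ℝ 2 f y) (ξ : ComplexSpace m) : HasLeviAt f y ξ (leviForm f y ξ) := by
  have := hasLeviAt_comp (φ := id) analyticAt_id hf ξ
  simpa using this

theorem leviForm_comp {f : ComplexSpace k → ℝ} {φ : ComplexSpace m → ComplexSpace k}
    {y : ComplexSpace m} (hφ : AnalyticAt ℂ φ y) (hf : ContDiffAt ℝ 2 f (φ y))
    (ξ : ComplexSpace m) :
    leviForm (fun z => f (φ z)) y ξ = leviForm f (φ y) (fderiv ℂ φ y ξ) :=
  (hasLeviAt_leviForm (hf.comp y (hφ.restrictScalars (𝕜 := ℝ)).contDiffAt) ξ).unique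
    (hasLeviAt_comp hφ hf ξ)

/-! ### Levi forms of the comparison functions -/

theorem isLittleO_sq_of_eventuallyEq_mul {f h : ℝ → ℝ} (hf : f =ᶠ[𝓝 0] fun s => s ^ 2 * h s)
    (hh : Tendsto h (𝓝 0) (𝓝 0)) : f =o[𝓝 0] fun s : ℝ => s ^ 2 := by
  refine IsLittleO.congr' ?_ hf.symm (EventuallyEq.refl _ _)
  simpa using (isBigO_refl (fun s : ℝ => s ^ 2) (𝓝 0)).mul_isLittleO (isLittleO_one_iff ℝ |>.2 hh)

/-- The barrier for the Hopf lemma. On the complex line through `x₀` and `y` it is a constant times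
`|1 / (1 + t)|²`, the squared modulus of a holomorphic function. The witness `h` is the exact
four-point remainder divided by `s ^ 2`. -/
theorem hasLeviAt_norm_sub_inv_sq {E : Type*} [NormedAddCommGroup E] [NormedSpace ℂ E] {x₀ y : E}
    (hy : y ≠ x₀) :
    HasLeviAt (fun z => (‖z - x₀‖ ^ 2)⁻¹) y (y - x₀) (‖y - x₀‖ ^ 2)⁻¹ := by
  have hR : ‖y - x₀‖ ≠ 0 := by simpa [sub_eq_zero] using hy
  have key : ∀ c : ℂ, ‖y + c • (y - x₀) - x₀‖ ^ 2 = Complex.normSq (1 + c) * ‖y - x₀‖ ^ 2 := by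
    intro c
    rw [show y + c • (y - x₀) - x₀ = (1 + c) • (y - x₀) by module, norm_smul, mul_pow,
      Complex.sq_norm]
  refine isLittleO_sq_of_eventuallyEq_mul (h := fun s =>
    (‖y - x₀‖ ^ 2)⁻¹ * (s ^ 2 * (4 * (3 - s ^ 4)) / ((1 - s ^ 2) ^ 2 * (1 + s ^ 2)))) ?_ ?_
  · have hs : ∀ᶠ s : ℝ in 𝓝 0, |s| < 1 := by
      have := Metric.ball_mem_nhds (0 : ℝ) one_pos
      filter_upwards [this] with s hs
      simpa using hs
    filter_upwards [hs] with s hs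
    obtain ⟨h1, h2⟩ := abs_lt.1 hs
    simp only [key]
    have e1 : Complex.normSq (1 + (s : ℂ)) = (1 + s) ^ 2 := by
      simp [Complex.normSq_apply]; ring
    have e2 : Complex.normSq (1 + (-s : ℂ)) = (1 - s) ^ 2 := by
      simp [Complex.normSq_apply]; ring
    have e3 : Complex.normSq (1 + Complex.I * s) = 1 + s ^ 2 := by
      simp [Complex.normSq_apply]; ring
    have e4 : Complex.normSq (1 + -(Complex.I * s)) = 1 + s ^ 2 := by
      simp [Complex.normSq_apply]; ring
    rw [e1, e2, e3, e4]
    have f1 : 1 + s ≠ 0 := by linarith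
    have f2 : 1 - s ≠ 0 := by linarith
    have f3 : 1 + s ^ 2 ≠ 0 := by positivity
    have f4 : (1 - s ^ 2) ≠ 0 := by
      rw [show 1 - s ^ 2 = (1 - s) * (1 + s) by ring]; exact mul_ne_zero f2 f1
    field_simp
    ring
  · have : ContinuousAt (fun s : ℝ =>
        (‖y - x₀‖ ^ 2)⁻¹ * (s ^ 2 * (4 * (3 - s ^ 4)) / ((1 - s ^ 2) ^ 2 * (1 + s ^ 2)))) 0 :=
      ContinuousAt.mul continuousAt_const (ContinuousAt.div (by fun_prop) (by fun_prop) (by norm_num))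
    simpa [ContinuousAt] using this

theorem hasLeviAt_norm_sub_sq (p y ξ : ComplexSpace m) :
    HasLeviAt (fun z => ‖z - p‖ ^ 2) y ξ (‖ξ‖ ^ 2) := by
  refine isLittleO_sq_of_eventuallyEq_mul (h := fun _ => 0) (Eventually.of_forall fun s => ?_)
    tendsto_const_nhds
  have key : ∀ c : ℂ, ‖y + c • ξ - p‖ ^ 2 + ‖y + (-c) • ξ - p‖ ^ 2
      = 2 * (‖y - p‖ ^ 2 + ‖c‖ ^ 2 * ‖ξ‖ ^ 2) := by
    intro c
    have := parallelogram_law_with_norm ℂ (y - p) (c • ξ)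
    rw [norm_smul] at this
    rw [show y + c • ξ - p = y - p + c • ξ by module, show y + (-c) • ξ - p = y - p - c • ξ by module]
    linear_combination this
  have h1 := key s
  have h2 := key (Complex.I * s)
  simp only [norm_mul, Complex.norm_I, one_mul, Complex.norm_real, Real.norm_eq_abs, sq_abs] at h1 h2
  linear_combination h1 + h2

/-- When `P` is stationary along a complex direction, `|P - ζ|²` has no `t t̄` term there, so it can
be used as a penalty of any size without affecting the Levi form. -/
theorem hasLeviAt_norm_sq_sub_of_forall_eq {E : Type*} [NormedAddCommGroup E] [NormedSpace ℂ E]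
    {P : E → ℂ} {y ξ : E} {b : ℂ} (ζ : ℂ) (h : ∀ t : ℂ, P (y + t • ξ) = P y + t ^ 2 * b) :
    HasLeviAt (fun z => ‖P z - ζ‖ ^ 2) y ξ 0 := by
  refine isLittleO_sq_of_eventuallyEq_mul (h := fun s => s ^ 2 * (4 * ‖b‖ ^ 2))
    (Eventually.of_forall fun s => ?_) (Continuous.tendsto' (by fun_prop) _ _ (by simp))
  have key : ∀ t : ℂ, ‖P (y + t • ξ) - ζ‖ ^ 2 = Complex.normSq (P y - ζ + t ^ 2 * b) := by
    intro t
    rw [h, Complex.sq_norm]; congr 1; ring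
  simp only [key, mul_pow, Complex.I_sq, neg_sq, Complex.sq_norm]
  simp only [← Complex.ofReal_pow, Complex.normSq_apply, Complex.add_re, Complex.add_im,
    Complex.mul_re, Complex.mul_im, Complex.ofReal_re, Complex.ofReal_im, Complex.neg_re,
    Complex.neg_im, Complex.one_re, Complex.one_im]
  ring

/-! ### Hopf lemma and strong maximum principle -/

/-- The Hopf lemma for plurisubharmonic functions. -/
theorem fderiv_pos_of_neg_on_ball {u : ComplexSpace m → ℝ} {x₀ p : ComplexSpace m} {R : ℝ}
    (hR : 0 < R) (hp : ‖p - x₀‖ = R) (hu : ContinuousOn u (Metric.closedBall x₀ R))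
    (hneg : ∀ y ∈ Metric.ball x₀ R, u y < 0) (hup : u p = 0)
    (hlevi : ∀ y ∈ Metric.ball x₀ R, ∀ ξ, ∃ L, 0 ≤ L ∧ HasLeviAt u y ξ L)
    (hd : DifferentiableAt ℝ u p) : 0 < fderiv ℝ u p (p - x₀) := by
  have hnp : ∀ y ∈ Metric.closedBall x₀ R, u y ≤ 0 := by
    intro y hy
    have hc := (hu y hy).mono Metric.ball_subset_closedBall
    rw [← closure_ball x₀ hR.ne'] at hy
    exact hc.closure_le hy continuousWithinAt_const fun z hz => (hneg z hz).le
  have hsub : Metric.closedBall x₀ (R / 2) ⊆ Metric.ball x₀ R :=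
    Metric.closedBall_subset_ball (by linarith)
  obtain ⟨a, ha, hua⟩ := (isCompact_closedBall x₀ (R / 2)).exists_forall_le'
    (f := fun y => -u y) (a := 0)
    ((hu.mono (hsub.trans Metric.ball_subset_closedBall)).neg)
    (fun y hy => by simpa using hneg y (hsub hy))
  -- The barrier grows by `3 ε / R ^ 2 = a` from the outer sphere to the inner one, exactly offset
  -- by `u ≤ -a` inside.
  set ε := a * R ^ 2 / 3 with hε
  have hε0 : 0 < ε := by positivity
  set A := Metric.closedBall x₀ R \ Metric.ball x₀ (R / 2) with hA
  have hAc : IsCompact A := (isCompact_closedBall x₀ R).diff Metric.isOpen_ball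
  have hA0 : ∀ y ∈ A, R / 2 ≤ ‖y - x₀‖ ∧ ‖y - x₀‖ ≤ R := by
    intro y hy
    simpa [hA, dist_eq_norm, and_comm] using hy
  set g : ComplexSpace m → ℝ := fun y => u y + ε * (‖y - x₀‖ ^ 2)⁻¹ with hg
  have hpA : p ∈ A := by
    simp only [hA, Set.mem_sdiff, Metric.mem_closedBall, dist_eq_norm, hp, Metric.mem_ball]
    constructor <;> linarith
  have hgc : ContinuousOn g A := by
    refine (hu.mono Set.sdiff_subset).add (continuousOn_const.mul (ContinuousOn.inv₀ (by fun_prop) ?_))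
    intro y hy
    have := (hA0 y hy).1
    have : 0 < ‖y - x₀‖ := by linarith
    positivity
  obtain ⟨y, hyA, hymax⟩ := hAc.exists_isMaxOn ⟨p, hpA⟩ hgc
  have hgy : g y ≤ ε * (R ^ 2)⁻¹ := by
    by_contra! hlt
    obtain ⟨h1, h2⟩ := hA0 y hyA
    have hyc : y ∈ Metric.closedBall x₀ R := hyA.1
    have hne1 : ‖y - x₀‖ ≠ R / 2 := by
      intro he
      have : a ≤ -u y := hua y (by simp [dist_eq_norm, he])
      have h3 : ε * ((R / 2) ^ 2)⁻¹ = a + ε * (R ^ 2)⁻¹ := by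
        rw [hε]; field_simp; ring
      simp only [hg, he, h3] at hlt
      linarith
    have hne2 : ‖y - x₀‖ ≠ R := by
      intro he
      have := hnp y hyc
      simp only [hg, he] at hlt
      linarith
    have h1' : R / 2 < ‖y - x₀‖ := lt_of_le_of_ne h1 (Ne.symm hne1)
    have h2' : ‖y - x₀‖ < R := lt_of_le_of_ne h2 hne2
    have hyb : y ∈ Metric.ball x₀ R := by simpa [dist_eq_norm] using h2'
    have hnhds : A ∈ 𝓝 y := by
      have hc : Continuous fun z : ComplexSpace m => ‖z - x₀‖ := by fun_prop
      filter_upwards [hc.continuousAt.eventually (lt_mem_nhds h1'),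
        hc.continuousAt.eventually (gt_mem_nhds h2')] with z hz1 hz2
      simp only [hA, Set.mem_sdiff, Metric.mem_closedBall, dist_eq_norm, Metric.mem_ball]
      exact ⟨hz2.le, not_lt.2 hz1.le⟩
    have hyx : y ≠ x₀ := by
      rintro rfl
      simp at h1'; linarith
    -- At an interior maximum the radial complex direction suffices: there the barrier has positive
    -- Levi form.
    obtain ⟨L, hL, hLu⟩ := hlevi y hyb (y - x₀)
    have := (hLu.add ((hasLeviAt_norm_sub_inv_sq hyx).const_mul ε)).nonpos_of_isLocalMax
      (hymax.isLocalMax hnhds)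
    have hpos : 0 < ‖y - x₀‖ := by linarith
    have : 0 < ε * (‖y - x₀‖ ^ 2)⁻¹ := by positivity
    linarith
  have hline : HasDerivAt (fun τ : ℝ => u (p + τ • (x₀ - p))) (fderiv ℝ u p (x₀ - p)) 0 := by
    have h1 : HasDerivAt (fun τ : ℝ => p + τ • (x₀ - p)) (x₀ - p) 0 := by
      simpa using ((hasDerivAt_id (0 : ℝ)).smul_const (x₀ - p)).const_add p
    have h2 : HasFDerivAt u (fderiv ℝ u p) (p + (0 : ℝ) • (x₀ - p)) := by
      simpa using hd.hasFDerivAt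
    exact h2.comp_hasDerivAt (0 : ℝ) h1
  have hslope := hline.tendsto_slope_zero_right
  have hle : fderiv ℝ u p (x₀ - p) ≤ -(2 * ε * (R ^ 2)⁻¹) := by
    refine le_of_tendsto hslope ?_
    filter_upwards [Ioo_mem_nhdsGT (show (0 : ℝ) < 1 / 2 by norm_num)] with τ hτ
    have hτ1 : 0 < 1 - τ := by linarith [hτ.2]
    have hnorm : ‖p + τ • (x₀ - p) - x₀‖ = (1 - τ) * R := by
      rw [show p + τ • (x₀ - p) - x₀ = (1 - τ) • (p - x₀) by module, norm_smul, hp,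
        Real.norm_of_nonneg hτ1.le]
    have hmem : p + τ • (x₀ - p) ∈ A := by
      simp only [hA, Set.mem_sdiff, Metric.mem_closedBall, dist_eq_norm, hnorm, Metric.mem_ball]
      constructor <;> nlinarith [hτ.1, hτ.2]
    have h1 := (hymax hmem).trans hgy
    simp only [hg, hnorm] at h1
    simp only [zero_add, zero_smul, add_zero, hup, sub_zero, smul_eq_mul]
    -- From `(1 - τ)⁻² ≥ 1 + 2τ`, the bound on `g` makes `u` decrease at least linearly along the
    -- inward normal.
    have h2 : (1 + 2 * τ) * (R ^ 2)⁻¹ ≤ (((1 - τ) * R) ^ 2)⁻¹ := by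
      rw [mul_pow, mul_inv]
      gcongr
      rw [le_inv_comm₀ (by linarith [hτ.1]) (by positivity), inv_eq_one_div, le_div_iff₀ (by linarith [hτ.1])]
      nlinarith [hτ.1, hτ.2, mul_pos hτ.1 hτ.1, mul_pos hτ.1 (sub_pos.2 hτ.2)]
    have h3 := mul_le_mul_of_nonneg_left h2 hε0.le
    rw [inv_mul_le_iff₀ hτ.1]
    nlinarith
  have : fderiv ℝ u p (p - x₀) = - fderiv ℝ u p (x₀ - p) := by
    rw [← map_neg, neg_sub]
  rw [this]
  have : 0 < 2 * ε * (R ^ 2)⁻¹ := by positivity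
  linarith

/-- The strong maximum principle near an interior maximum of a plurisubharmonic function. -/
theorem eq_zero_near_of_nonpos {u : ComplexSpace m → ℝ} {z₀ : ComplexSpace m} {r : ℝ}
    (hd : ∀ y ∈ Metric.ball z₀ r, DifferentiableAt ℝ u y)
    (hnp : ∀ y ∈ Metric.ball z₀ r, u y ≤ 0) (hu0 : u z₀ = 0)
    (hlevi : ∀ y ∈ Metric.ball z₀ r, ∀ ξ, ∃ L, 0 ≤ L ∧ HasLeviAt u y ξ L) :
    ∀ y ∈ Metric.ball z₀ (r / 2), u y = 0 := by
  intro y hy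
  by_contra hne
  have hd0 : dist z₀ y < r / 2 := by rwa [dist_comm]
  have hsub : Metric.closedBall y (dist z₀ y) ⊆ Metric.ball z₀ r := by
    refine Metric.closedBall_subset_ball' ?_
    rw [dist_comm y z₀]; linarith
  have hcont : ContinuousOn u (Metric.closedBall y (dist z₀ y)) := fun z hz =>
    (hd z (hsub hz)).continuousAt.continuousWithinAt
  have hK : IsCompact (Metric.closedBall y (dist z₀ y) ∩ u ⁻¹' {0}) :=
    (isCompact_closedBall _ _).of_isClosed_subset
      (hcont.preimage_isClosed_of_isClosed Metric.isClosed_closedBall isClosed_singleton)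
      Set.inter_subset_left
  -- At a zero nearest to `y` the Hopf lemma gives a nonzero derivative, although `u` has an
  -- interior maximum there.
  obtain ⟨z₁, hz₁, hmin⟩ := hK.exists_isMinOn ⟨z₀, by simp, hu0⟩
    (f := fun z => dist z y) (by fun_prop)
  have hz₁u : u z₁ = 0 := hz₁.2
  have hz₁y : z₁ ≠ y := by rintro rfl; exact hne hz₁u
  have hsub2 : Metric.closedBall y (dist z₁ y) ⊆ Metric.closedBall y (dist z₀ y) :=
    Metric.closedBall_subset_closedBall hz₁.1
  have hpos := fderiv_pos_of_neg_on_ball (u := u) (x₀ := y) (p := z₁) (R := dist z₁ y)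
    (dist_pos.2 hz₁y) (dist_eq_norm _ _).symm (hcont.mono hsub2)
    (fun z hz => lt_of_le_of_ne (hnp z (hsub (hsub2 (Metric.ball_subset_closedBall hz)))) fun h0 =>
      not_lt.2 (isMinOn_iff.1 hmin z ⟨hsub2 (Metric.ball_subset_closedBall hz), h0⟩)
        (Metric.mem_ball.1 hz))
    hz₁u (fun z hz => hlevi z (hsub (hsub2 (Metric.ball_subset_closedBall hz))))
    (hd z₁ (hsub hz₁.1))
  have hmax : IsLocalMax u z₁ := by
    filter_upwards [Metric.isOpen_ball.mem_nhds (hsub hz₁.1)] with z hz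
    rw [hz₁u]; exact hnp z hz
  rw [hmax.fderiv_eq_zero] at hpos
  simp at hpos

/-! ### Levi polynomial and sign on the pseudoconvex side -/

/-- The Levi polynomial of a real second order jet. In each point it is constant to first order in
some complex direction. -/
theorem exists_levi_polynomial (hm : 2 ≤ m) (D : ComplexSpace m →L[ℝ] ℝ)
    (H : ComplexSpace m →L[ℝ] ComplexSpace m →L[ℝ] ℝ) (hH : ∀ x y, H x y = H y x) :
    ∃ P : ComplexSpace m → ℂ, Continuous P ∧ P 0 = 0 ∧
      (∀ x, (P x).re = D x + (H x x - H (Complex.I • x) (Complex.I • x)) / 4) ∧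
      ∀ x, ∃ ξ, ξ ≠ 0 ∧ ∃ b : ℂ, ∀ t : ℂ, P (x + t • ξ) = P x + t ^ 2 * b := by
  -- The real part is the second order Taylor polynomial minus the Levi form; the imaginary part
  -- makes it a holomorphic quadratic polynomial.
  refine ⟨fun x => ((D x + (H x x - H (Complex.I • x) (Complex.I • x)) / 4 : ℝ) : ℂ)
    + ((-D (Complex.I • x) - H x (Complex.I • x) / 2 : ℝ) : ℂ) * Complex.I, by fun_prop, by simp,
    fun x => by simp, fun x => ?_⟩
  -- This is the real part of the differential of `P` at `x`. Its complex linear extension has a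
  -- nonzero kernel because `m ≥ 2`.
  let fr : ComplexSpace m →ₗ[ℝ] ℝ :=
    { toFun := fun y => D y + (H x y - H (Complex.I • x) (Complex.I • y)) / 2
      map_add' := fun y z => by simp only [map_add, smul_add]; ring
      map_smul' := fun c y => by
        simp only [map_smul, smul_comm Complex.I c y, smul_eq_mul, RingHom.id_apply]; ring }
  have hker : (Module.Dual.extendRCLike (𝕜 := ℂ) fr).ker ≠ ⊥ := by
    refine LinearMap.ker_ne_bot_of_finrank_lt ?_
    simp
    omega
  obtain ⟨ξ, hξ, hξ0⟩ := Submodule.exists_mem_ne_zero_of_ne_bot hker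
  have hF : ((fr ξ : ℝ) : ℂ) - Complex.I * (fr (Complex.I • ξ) : ℝ) = 0 := by
    simpa [Module.Dual.extendRCLike_apply] using hξ
  have h1 : D ξ + (H x ξ - H (Complex.I • x) (Complex.I • ξ)) / 2 = 0 := by
    have h : fr ξ = 0 := by simpa using congrArg Complex.re hF
    exact h
  have h2 : D (Complex.I • ξ) + (H x (Complex.I • ξ) - H (Complex.I • x) (Complex.I • Complex.I • ξ)) / 2
      = 0 := by
    have h : fr (Complex.I • ξ) = 0 := by simpa using congrArg Complex.im hF
    exact h
  have hJ : ∀ z : ComplexSpace m, Complex.I • Complex.I • z = -z := fun z => by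
    rw [smul_smul, Complex.I_mul_I, neg_one_smul]
  rw [hJ, map_neg] at h2
  refine ⟨ξ, hξ0, ((H ξ ξ - H (Complex.I • ξ) (Complex.I • ξ)) / 4 : ℝ)
    + ((- H ξ (Complex.I • ξ) / 2 : ℝ) : ℂ) * Complex.I, fun t => ?_⟩
  have ht : t • ξ = t.re • ξ + t.im • Complex.I • ξ := by
    conv_lhs => rw [← Complex.re_add_im t]
    rw [add_smul, mul_smul, Complex.coe_smul, Complex.coe_smul]
  have hIt : Complex.I • (x + t • ξ) = Complex.I • x + t.re • Complex.I • ξ - t.im • ξ := by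
    rw [ht, smul_add, smul_add, smul_comm Complex.I t.re, smul_comm Complex.I t.im, hJ, smul_neg]
    abel
  have s1 := hH (Complex.I • x) x
  have s2 := hH ξ x
  have s3 := hH (Complex.I • ξ) x
  have s4 := hH ξ (Complex.I • x)
  have s5 := hH (Complex.I • ξ) (Complex.I • x)
  have s6 := hH (Complex.I • ξ) ξ
  beta_reduce
  rw [hIt, ht]
  apply Complex.ext
  · simp only [map_add, map_sub, map_smul, add_apply, sub_apply, smul_apply, smul_eq_mul, pow_two,
      Complex.add_re, Complex.mul_re, Complex.ofReal_re, Complex.ofReal_im, Complex.I_re,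
      Complex.I_im, Complex.add_im, Complex.mul_im]
    simp only [s2, s3, s4, s5, s6]
    linear_combination t.re * h1 + t.im * h2
  · simp only [map_add, map_sub, map_smul, add_apply, sub_apply, smul_apply, smul_eq_mul, pow_two,
      Complex.add_re, Complex.mul_re, Complex.ofReal_re, Complex.ofReal_im, Complex.I_re,
      Complex.I_im, Complex.add_im, Complex.mul_im]
    simp only [s4, s5, s6]
    linear_combination t.im * h1 - t.re * h2

/-- A plurisubharmonic function that vanishes on a strongly pseudoconvex hypersurface is nonpositive
on the pseudoconvex side. -/
theorem eventually_nonpos_of_eq_zero_on_hypersurface (hm : 2 ≤ m) {ρ u : ComplexSpace m → ℝ}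
    {p : ComplexSpace m} (hρ : ContDiffAt ℝ 2 ρ p) (hρp : ρ p = 0) {c : ℝ} (hc : 0 < c)
    (hlevi : ∀ v, c * ‖v‖ ^ 2 ≤ leviForm ρ p v)
    (hu : ∀ᶠ z in 𝓝 p, ContinuousAt ρ z ∧ ContinuousAt u z ∧ (ρ z = 0 → u z = 0) ∧
      ∀ ξ, ∃ L, 0 ≤ L ∧ HasLeviAt u z ξ L) :
    ∀ᶠ z in 𝓝 p, ρ z ≤ 0 → u z ≤ 0 := by
  obtain ⟨P, hPc, hP0, hPre, hPξ⟩ := exists_levi_polynomial hm (fderiv ℝ ρ p)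
    (fderiv ℝ (fderiv ℝ ρ) p) fun x y => (hρ.isSymmSndFDerivAt (by simp)).eq x y
  have hT : ∀ᶠ x in 𝓝 (0 : ComplexSpace m), (P x).re + c / 2 * ‖x‖ ^ 2 ≤ ρ (p + x) := by
    filter_upwards [isLittleO_iff.1 (taylor_two_isLittleO hρ) (half_pos hc)] with x hx
    have h1 := hlevi x
    rw [Real.norm_eq_abs, Real.norm_of_nonneg (by positivity)] at hx
    have h2 := (abs_le.1 hx).1
    rw [leviForm] at h1
    rw [hPre]
    rw [hρp, smul_eq_mul] at h2
    linarith
  have htr : Tendsto (fun z => z - p) (𝓝 p) (𝓝 0) :=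
    Continuous.tendsto' (by fun_prop) _ _ (sub_self p)
  obtain ⟨r₁, hr₁, hball⟩ := Metric.eventually_nhds_iff_ball.1 (hu.and (htr.eventually hT))
  set r := r₁ / 2 with hr
  have hr0 : 0 < r := half_pos hr₁
  have hsub : Metric.closedBall p r ⊆ Metric.ball p r₁ :=
    Metric.closedBall_subset_ball (by linarith)
  have hucont : ContinuousOn u (Metric.closedBall p r) := fun z hz =>
    (hball z (hsub hz)).1.2.1.continuousWithinAt
  have hρcont : ContinuousOn ρ (Metric.closedBall p r) := fun z hz =>
    (hball z (hsub hz)).1.1.continuousWithinAt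
  set K := Metric.closedBall p r ∩ ρ ⁻¹' Set.Iic 0 with hK
  have hKc : IsCompact K := (isCompact_closedBall _ _).of_isClosed_subset
    (hρcont.preimage_isClosed_of_isClosed Metric.isClosed_closedBall isClosed_Iic)
    Set.inter_subset_left
  obtain ⟨C, hC⟩ := (isCompact_closedBall p r).exists_bound_of_continuousOn hucont
  have hC0 : 0 ≤ C := (norm_nonneg _).trans (hC p (Metric.mem_closedBall_self hr0.le))
  -- On the outer sphere `ρ ≤ 0` forces `Re P ≤ -2d`. With `|ζ| < d` this gives `|P - ζ| ≥ d`, so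
  -- the penalty, with `N d ^ 2 = C`, outweighs `u`.
  set d := c / 4 * r ^ 2 with hd
  have hd0 : 0 < d := by positivity
  have hPsmall : ∀ᶠ z in 𝓝 p, ‖P (z - p)‖ < d := by
    have : Tendsto (fun z => ‖P (z - p)‖) (𝓝 p) (𝓝 0) :=
      Continuous.tendsto' (by fun_prop) _ _ (by simp [hP0])
    exact this.eventually (gt_mem_nhds hd0)
  filter_upwards [hPsmall, Metric.closedBall_mem_nhds p hr0] with z₀ hz₀P hz₀r hz₀ρ
  set ζ := P (z₀ - p) with hζ
  set N := C / d ^ 2 with hN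
  have hN0 : 0 ≤ N := by positivity
  have main : ∀ ε : ℝ, 0 < ε → u z₀ ≤ ε * r ^ 2 := by
    intro ε hε
    set g : ComplexSpace m → ℝ := fun z => u z + ε * ‖z - p‖ ^ 2 + (-N) * ‖P (z - p) - ζ‖ ^ 2
      with hg
    obtain ⟨z₁, hz₁K, hz₁⟩ := hKc.exists_isMaxOn ⟨z₀, hz₀r, hz₀ρ⟩ (f := g)
      (((hucont.mono Set.inter_subset_left).add (by fun_prop)).add (by fun_prop))
    have hz₁r : ‖z₁ - p‖ ≤ r := by simpa [dist_eq_norm] using hz₁K.1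
    have hz₁b := hball z₁ (hsub hz₁K.1)
    have hn1 : ε * ‖z₁ - p‖ ^ 2 ≤ ε * r ^ 2 := by gcongr
    have hgz₁ : g z₁ ≤ ε * r ^ 2 := by
      by_cases hρ0 : ρ z₁ = 0
      · have h1 : u z₁ = 0 := hz₁b.1.2.2.1 hρ0
        have h2 : 0 ≤ N * ‖P (z₁ - p) - ζ‖ ^ 2 := by positivity
        simp only [hg]
        linarith
      have hρlt : ρ z₁ < 0 := lt_of_le_of_ne hz₁K.2 hρ0
      rcases hz₁r.lt_or_eq with hlt | heq
      · exfalso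
        have hnhds : K ∈ 𝓝 z₁ := by
          refine inter_mem (mem_of_superset (Metric.isOpen_ball.mem_nhds ?_)
            Metric.ball_subset_closedBall) ?_
          · simpa [dist_eq_norm] using hlt
          · filter_upwards [hz₁b.1.1.eventually (gt_mem_nhds hρlt)] with z hz using hz.le
        -- Along `ξ` the penalty contributes nothing to the Levi form and the `ε` term is strictly
        -- positive, which excludes an interior maximum.
        obtain ⟨ξ, hξ0, b, hb⟩ := hPξ (z₁ - p)
        obtain ⟨L, hL, hLu⟩ := hz₁b.1.2.2.2 ξ
        have hLP : HasLeviAt (fun z => ‖P (z - p) - ζ‖ ^ 2) z₁ ξ 0 :=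
          hasLeviAt_norm_sq_sub_of_forall_eq (P := fun z => P (z - p)) (b := b) ζ fun t => by
            rw [← hb t]; congr 1; abel
        have := ((hLu.add ((hasLeviAt_norm_sub_sq p z₁ ξ).const_mul ε)).add
          (hLP.const_mul (-N))).nonpos_of_isLocalMax (hz₁.isLocalMax hnhds)
        have hpos : 0 < ε * ‖ξ‖ ^ 2 := by
          have := norm_pos_iff.2 hξ0
          positivity
        linarith
      · have h1 : (P (z₁ - p)).re + c / 2 * ‖z₁ - p‖ ^ 2 ≤ ρ z₁ := by
          simpa using hz₁b.2
        have h2 : d ≤ ‖P (z₁ - p) - ζ‖ := by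
          have h3 : |(P (z₁ - p)).re| ≤ ‖P (z₁ - p)‖ := Complex.abs_re_le_norm _
          have h4 := norm_sub_norm_le (P (z₁ - p)) ζ
          have h5 := neg_abs_le (P (z₁ - p)).re
          rw [heq] at h1
          linarith
        have h3 : C ≤ N * ‖P (z₁ - p) - ζ‖ ^ 2 := by
          calc C = N * d ^ 2 := by rw [hN]; field_simp
            _ ≤ _ := by gcongr
        have h4 : u z₁ ≤ C := (le_abs_self _).trans (hC z₁ hz₁K.1)
        simp only [hg]
        linarith
    have h0 : g z₀ ≤ g z₁ := hz₁ ⟨hz₀r, hz₀ρ⟩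
    have h1 : u z₀ ≤ g z₀ := by
      simp only [hg, hζ, sub_self, norm_zero]
      have : 0 ≤ ε * ‖z₀ - p‖ ^ 2 := by positivity
      linarith
    linarith
  by_contra! hpos
  have := main (u z₀ / (2 * r ^ 2)) (by positivity)
  have h2 : u z₀ / (2 * r ^ 2) * r ^ 2 = u z₀ / 2 := by field_simp
  linarith

/-! ### Strictly plurisubharmonic defining functions -/

theorem leviForm_smul (ρ : ComplexSpace m → ℝ) (z v : ComplexSpace m) (t : ℝ) :
    leviForm ρ z (t • v) = t ^ 2 * leviForm ρ z v := by
  simp only [leviForm, map_smul, smul_comm Complex.I t v, smul_apply, smul_eq_mul]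
  ring

theorem continuous_leviForm (ρ : ComplexSpace m → ℝ) (z : ComplexSpace m) :
    Continuous (leviForm ρ z) := by
  unfold leviForm
  fun_prop

/-- By homogeneity only the unit sphere matters. Where `A ≤ 0` there, `B` has a positive minimum by
compactness, so a large `K` wins. -/
theorem exists_pos_le_add_mul {A B : ComplexSpace m → ℝ} (hA : Continuous A) (hB : Continuous B)
    (hAs : ∀ (t : ℝ) v, A (t • v) = t ^ 2 * A v) (hBs : ∀ (t : ℝ) v, B (t • v) = t ^ 2 * B v)
    (hB0 : ∀ v, 0 ≤ B v) (h : ∀ v, B v = 0 → v ≠ 0 → 0 < A v) :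
    ∃ K c : ℝ, 0 < c ∧ ∀ v, c * ‖v‖ ^ 2 ≤ A v + K * B v := by
  have hS : IsCompact (Metric.sphere (0 : ComplexSpace m) 1) := isCompact_sphere _ _
  have hS0 : ∀ v ∈ Metric.sphere (0 : ComplexSpace m) 1, v ≠ 0 := by
    rintro v hv rfl
    simp at hv
  obtain ⟨a, ha⟩ := hS.exists_bound_of_continuousOn hA.continuousOn
  obtain ⟨b, hb0, hb⟩ := (hS.inter_right (isClosed_le hA continuous_const)).exists_forall_le'
    (f := B) (a := 0) hB.continuousOn (fun v hv => lt_of_le_of_ne (hB0 v) fun h0 =>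
      not_lt.2 hv.2 (h v h0.symm (hS0 v hv.1)))
  set K := (|a| + 1) / b
  have hK : 0 ≤ K := by positivity
  have hKb : K * b = |a| + 1 := by simp only [K]; field_simp
  obtain ⟨c, hc0, hc⟩ := hS.exists_forall_le' (f := fun v => A v + K * B v) (a := 0)
    (by fun_prop) (fun v hv => by
      by_cases hAv : A v ≤ 0
      · have h1 := mul_le_mul_of_nonneg_left (hb v ⟨hv, hAv⟩) hK
        have h2 := (abs_le.1 ((ha v hv).trans (le_abs_self a))).1
        linarith
      · have := mul_nonneg hK (hB0 v)
        linarith)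
  refine ⟨K, c, hc0, fun v => ?_⟩
  rcases eq_or_ne v 0 with rfl | hv
  · have h1 := hAs 0 0
    have h2 := hBs 0 0
    simp at h1 h2
    simp [h1, h2]
  · have hn : ‖v‖ ≠ 0 := norm_ne_zero_iff.2 hv
    have h1 := hc (‖v‖⁻¹ • v) (by simp [norm_smul, hn])
    rw [hAs, hBs] at h1
    have h2 := mul_le_mul_of_nonneg_left h1 (sq_nonneg ‖v‖)
    have h3 : ‖v‖ ^ 2 * (‖v‖⁻¹ ^ 2 * A v + K * (‖v‖⁻¹ ^ 2 * B v)) = A v + K * B v := by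
      field_simp
    linarith

theorem fderiv_add_mul_sq {ρ : ComplexSpace m → ℝ} {z : ComplexSpace m} (K : ℝ)
    (hρ : DifferentiableAt ℝ ρ z) :
    fderiv ℝ (fun y => ρ y + K * ρ y ^ 2) z = (1 + 2 * K * ρ z) • fderiv ℝ ρ z := by
  have h := hρ.hasFDerivAt.add ((hρ.hasFDerivAt.pow 2).const_mul K)
  refine h.fderiv.trans ?_
  ext v
  simp
  ring

/-- The added term is a square that vanishes exactly on the complex tangent space, so it can repair
the Levi form in transverse directions. -/
theorem leviForm_add_mul_sq {ρ : ComplexSpace m → ℝ} {z : ComplexSpace m} (K : ℝ)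
    (hρ : ContDiffAt ℝ 2 ρ z) (hz : ρ z = 0) (v : ComplexSpace m) :
    leviForm (fun y => ρ y + K * ρ y ^ 2) z v
      = leviForm ρ z v + K * ((fderiv ℝ ρ z v ^ 2 + fderiv ℝ ρ z (Complex.I • v) ^ 2) / 2) := by
  have h1 : fderiv ℝ (fun y => ρ y + K * ρ y ^ 2) =ᶠ[𝓝 z]
      fun y => (1 + 2 * K * ρ y) • fderiv ℝ ρ y := by
    filter_upwards [hρ.eventually (by simp)] with y hy
    exact fderiv_add_mul_sq K (hy.differentiableAt (by simp))
  have h2 : HasFDerivAt (fderiv ℝ ρ) (fderiv ℝ (fderiv ℝ ρ) z) z :=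
    ((hρ.fderiv_right (m := 1) (by norm_num)).differentiableAt (by simp)).hasFDerivAt
  have h3 := (((hρ.differentiableAt (by simp)).hasFDerivAt.const_mul (2 * K)).const_add 1).smul h2
  have h4 := h1.fderiv_eq.trans h3.fderiv
  simp only [leviForm, h4, hz]
  simp
  ring

/-- Near each point, a strongly pseudoconvex hypersurface has a strictly plurisubharmonic defining
function. -/
theorem IsStronglyPseudoconvexAnalyticHypersurface.exists_strictly_plurisubharmonic
    {M : Set (ComplexSpace m)} (hM : IsStronglyPseudoconvexAnalyticHypersurface M)
    {q : ComplexSpace m} (hq : q ∈ M) :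
    ∃ (V : Set (ComplexSpace m)) (ρ : ComplexSpace m → ℝ), q ∈ V ∧
      IsAnalyticDefiningFunction M V ρ ∧
      ∃ c, 0 < c ∧ ∀ z ∈ V, ∀ v, c * ‖v‖ ^ 2 ≤ leviForm ρ z v := by
  obtain ⟨V, ρ, hqV, hρ, hpos⟩ := hM q hq
  have hρq : ρ q = 0 := by
    have : q ∈ M ∩ V := ⟨hq, hqV⟩
    rw [hρ.inter_eq] at this
    exact this.2
  obtain ⟨K, c, hc, hKc⟩ := exists_pos_le_add_mul (A := leviForm ρ q)
    (B := fun v => (fderiv ℝ ρ q v ^ 2 + fderiv ℝ ρ q (Complex.I • v) ^ 2) / 2)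
    (continuous_leviForm ρ q) (by fun_prop) (fun t v => leviForm_smul ρ q v t)
    (fun t v => by simp only [map_smul, smul_comm Complex.I t v, smul_eq_mul]; ring)
    (fun v => by positivity)
    (fun v hv hv0 => hpos v (by
      have h1 := sq_nonneg (fderiv ℝ ρ q v)
      have h2 := sq_nonneg (fderiv ℝ ρ q (Complex.I • v))
      constructor
      · exact pow_eq_zero_iff two_ne_zero |>.1 (by linarith)
      · exact pow_eq_zero_iff two_ne_zero |>.1 (by linarith)) hv0)
  set ρ₂ : ComplexSpace m → ℝ := fun y => ρ y + K * ρ y ^ 2 with hρ₂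
  have hρ₂a : AnalyticOnNhd ℝ ρ₂ V := fun z hz =>
    (hρ.analytic z hz).add (analyticAt_const.mul ((hρ.analytic z hz).pow 2))
  have hcont : ContinuousAt (fderiv ℝ (fderiv ℝ ρ₂)) q := ((hρ₂a q hqV).fderiv.fderiv).continuousAt
  have e1 : ∀ᶠ z in 𝓝 q, ∀ v, c / 2 * ‖v‖ ^ 2 ≤ leviForm ρ₂ z v := by
    have hn : Tendsto (fun z => ‖fderiv ℝ (fderiv ℝ ρ₂) z - fderiv ℝ (fderiv ℝ ρ₂) q‖) (𝓝 q)
        (𝓝 0) :=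
      (tendsto_iff_norm_sub_tendsto_zero
        (E := ComplexSpace m →L[ℝ] ComplexSpace m →L[ℝ] ℝ)).1 hcont
    filter_upwards [hn.eventually (gt_mem_nhds hc)] with z hz v
    have h1 := hKc v
    rw [← leviForm_add_mul_sq K (hρ.analytic q hqV).contDiffAt hρq v] at h1
    set T := fderiv ℝ (fderiv ℝ ρ₂) z - fderiv ℝ (fderiv ℝ ρ₂) q with hT
    have h2 : ∀ w, |T w w| ≤ c * ‖w‖ ^ 2 := fun w => by
      refine (T.le_opNorm₂ w w).trans ?_
      rw [mul_assoc, ← sq]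
      gcongr
    have h3 : leviForm ρ₂ z v = leviForm ρ₂ q v + (T v v + T (Complex.I • v) (Complex.I • v)) / 4 := by
      simp only [leviForm, hT, sub_apply]; ring
    have h4 := (abs_le.1 (h2 v)).1
    have h5 := (abs_le.1 (h2 (Complex.I • v))).1
    rw [norm_smul, Complex.norm_I, one_mul] at h5
    rw [h3]
    linarith
  have e2 : ∀ᶠ z in 𝓝 q, |2 * K * ρ z| < 1 := by
    have : Tendsto (fun z => |2 * K * ρ z|) (𝓝 q) (𝓝 0) := by
      have := ((hρ.analytic q hqV).continuousAt.const_mul (2 * K)).abs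
      simpa [ContinuousAt, hρq] using this
    exact this.eventually (gt_mem_nhds one_pos)
  obtain ⟨V', hV', hV'o, hqV'⟩ := eventually_nhds_iff.1
    ((e1.and e2).and (hρ.isOpen.mem_nhds hqV))
  refine ⟨V', ρ₂, hqV', ⟨hV'o, fun z hz => hρ₂a z (hV' z hz).2, fun z hz => ?_, ?_⟩, c / 2,
    half_pos hc, fun z hz => (hV' z hz).1.1⟩
  · rw [fderiv_add_mul_sq K (hρ.analytic z (hV' z hz).2).differentiableAt]
    have := (abs_lt.1 (hV' z hz).1.2).1
    exact smul_ne_zero (by linarith) (hρ.fderiv_ne_zero z (hV' z hz).2)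
  · ext z
    have key : z ∈ V' → (ρ₂ z = 0 ↔ ρ z = 0) := fun hz => by
      have h1 := (abs_lt.1 (hV' z hz).1.2).1
      have h2 : 1 + K * ρ z ≠ 0 := by linarith
      rw [show ρ₂ z = (1 + K * ρ z) * ρ z by simp only [hρ₂]; ring]
      simp [h2]
    have key2 : z ∈ V' → (z ∈ M ↔ ρ z = 0) := fun hz => by
      have : z ∈ M ∩ V ↔ z ∈ V ∧ ρ z = 0 := by rw [hρ.inter_eq]; rfl
      exact ⟨fun h => (this.1 ⟨h, (hV' z hz).2⟩).2, fun h => (this.2 ⟨(hV' z hz).2, h⟩).1⟩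
    constructor
    · rintro ⟨h1, h2⟩
      exact ⟨h2, (key h2).2 ((key2 h2).1 h1)⟩
    · rintro ⟨h1, h2⟩
      exact ⟨(key2 h1).2 ((key h1).1 h2), h1⟩

/-! ### Interior ball and dichotomy -/

/-- The interior ball condition for a `C²` hypersurface. -/
theorem exists_interior_ball {ρ : ComplexSpace m → ℝ} {p : ComplexSpace m}
    (hρ : ContDiffAt ℝ 2 ρ p) (hρp : ρ p = 0) (hD : fderiv ℝ ρ p ≠ 0) {δ : ℝ} (hδ : 0 < δ) :
    ∃ x₀ R, 0 < R ∧ ‖p - x₀‖ = R ∧ Metric.closedBall x₀ R ⊆ Metric.ball p δ ∧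
      ∀ y ∈ Metric.closedBall x₀ R, ρ y ≤ 0 := by
  set H := fderiv ℝ (fderiv ℝ ρ) p with hH
  obtain ⟨δ₁, hδ₁, hT⟩ := Metric.eventually_nhds_iff_ball.1
    (isLittleO_iff.1 (taylor_two_isLittleO hρ) one_pos)
  set ν := (InnerProductSpace.toDual ℝ (ComplexSpace m)).symm (fderiv ℝ ρ p) with hν
  have hνx : ∀ x, inner ℝ ν x = fderiv ℝ ρ p x := fun x => by simp [hν]
  have hν0 : 0 < ‖ν‖ := by
    rw [hν, LinearIsometryEquiv.norm_map]; exact norm_pos_iff.2 hD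
  set C := 1 + ‖H‖ / 2 with hC
  have hC0 : 0 < C := by positivity
  -- In the ball, `2t dρ(p)(y - p) ≤ -‖y - p‖²`, which absorbs the quadratic error `C ‖y - p‖²` once
  -- `2 C t ≤ 1`. The other bound keeps the ball near `p`.
  set t := min (1 / (2 * C)) (min δ δ₁ / (4 * ‖ν‖)) with ht
  have ht0 : 0 < t := by positivity
  have ht1 : t * (2 * C) ≤ 1 := by
    rw [← le_div_iff₀ (by positivity)]; exact min_le_left _ _
  have ht2 : t * (4 * ‖ν‖) ≤ min δ δ₁ := by
    rw [← le_div_iff₀ (by positivity)]; exact min_le_right _ _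
  have hR0 : 0 < t * ‖ν‖ := by positivity
  have hxy : ∀ y ∈ Metric.closedBall (p - t • ν) (t * ‖ν‖), ‖y - p‖ < min δ δ₁ := by
    intro y hy
    have h1 : ‖y - p‖ ≤ ‖y - (p - t • ν)‖ + ‖t • ν‖ := by
      rw [show y - p = (y - (p - t • ν)) - t • ν by abel]
      exact norm_sub_le _ _
    rw [norm_smul, Real.norm_of_nonneg ht0.le] at h1
    have h2 : ‖y - (p - t • ν)‖ ≤ t * ‖ν‖ := by simpa [dist_eq_norm] using hy
    linarith
  refine ⟨p - t • ν, t * ‖ν‖, hR0, ?_, fun y hy => ?_, fun y hy => ?_⟩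
  · rw [sub_sub_cancel, norm_smul, Real.norm_of_nonneg ht0.le]
  · rw [Metric.mem_ball, dist_eq_norm]
    exact (hxy y hy).trans_le (min_le_left _ _)
  · have h1 : ‖(y - p) + t • ν‖ ≤ t * ‖ν‖ := by
      rw [show (y - p) + t • ν = y - (p - t • ν) by abel]
      simpa [dist_eq_norm] using hy
    have h2 : ‖(y - p) + t • ν‖ ^ 2 ≤ (t * ‖ν‖) ^ 2 := by gcongr
    rw [norm_add_sq_real, inner_smul_right, real_inner_comm, hνx, norm_smul,
      Real.norm_of_nonneg ht0.le] at h2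
    have h3 := hT (y - p) (by simpa using (hxy y hy).trans_le (min_le_right _ _))
    rw [Real.norm_eq_abs, Real.norm_of_nonneg (by positivity), hρp, add_sub_cancel] at h3
    have h4 := (abs_le.1 h3).2
    have h5 : H (y - p) (y - p) ≤ ‖H‖ * ‖y - p‖ ^ 2 := by
      rw [sq, ← mul_assoc]; exact (le_abs_self _).trans (H.le_opNorm₂ _ _)
    rw [smul_eq_mul] at h4
    have h6 : t * ρ y ≤ t * (fderiv ℝ ρ p (y - p) + C * ‖y - p‖ ^ 2) := by
      gcongr
      rw [hC]; linarith
    have h7 : t * (2 * C) * ‖y - p‖ ^ 2 ≤ 1 * ‖y - p‖ ^ 2 := by gcongr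
    by_contra! hpos
    have := mul_pos ht0 hpos
    linarith

/-- Dichotomy from the Hopf lemma and the strong maximum principle. -/
theorem eventually_eq_zero_or_fderiv_ne_zero {ρ u : ComplexSpace m → ℝ} {p : ComplexSpace m}
    (hρ : ContDiffAt ℝ 2 ρ p) (hρp : ρ p = 0) (hD : fderiv ℝ ρ p ≠ 0) (hup : u p = 0)
    (hu : ∀ᶠ z in 𝓝 p, AnalyticAt ℝ u z ∧ (ρ z ≤ 0 → u z ≤ 0) ∧
      ∀ ξ, ∃ L, 0 ≤ L ∧ HasLeviAt u z ξ L) :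
    (∀ᶠ z in 𝓝 p, u z = 0) ∨ fderiv ℝ u p ≠ 0 := by
  obtain ⟨δ, hδ, hball⟩ := Metric.eventually_nhds_iff_ball.1 hu
  obtain ⟨x₀, R, hR, hp, hsub, hneg⟩ := exists_interior_ball hρ hρp hD hδ
  by_cases hlt : ∀ y ∈ Metric.ball x₀ R, u y < 0
  · right
    intro h0
    have := fderiv_pos_of_neg_on_ball hR hp
      (fun z hz => (hball z (hsub hz)).1.continuousAt.continuousWithinAt) hlt hup
      (fun y hy => (hball y (hsub (Metric.ball_subset_closedBall hy))).2.2)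
      (hball p (Metric.mem_ball_self hδ)).1.differentiableAt
    rw [h0] at this
    simp at this
  · left
    push Not at hlt
    obtain ⟨z₀, hz₀, hge⟩ := hlt
    have hB : Metric.ball x₀ R ⊆ Metric.ball p δ := Metric.ball_subset_closedBall.trans hsub
    obtain ⟨r, hr, hrsub⟩ := Metric.isOpen_iff.1 Metric.isOpen_ball z₀ hz₀
    have hnp : ∀ y ∈ Metric.ball x₀ R, u y ≤ 0 := fun y hy =>
      (hball y (hB hy)).2.1 (hneg y (Metric.ball_subset_closedBall hy))
    have hz := eq_zero_near_of_nonpos (u := u) (z₀ := z₀) (r := r)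
      (fun y hy => (hball y (hB (hrsub hy))).1.differentiableAt)
      (fun y hy => hnp y (hrsub hy)) (le_antisymm (hnp z₀ hz₀) hge)
      (fun y hy => (hball y (hB (hrsub hy))).2.2)
    have heq : Set.EqOn u 0 (Metric.ball p δ) :=
      AnalyticOnNhd.eqOn_of_preconnected_of_eventuallyEq (𝕜 := ℝ) (fun y hy => (hball y hy).1)
        (fun y _ => analyticAt_const) (convex_ball p δ).isPreconnected (hB hz₀)
        (by filter_upwards [Metric.ball_mem_nhds z₀ (half_pos hr)] with y hy using hz y hy)
    filter_upwards [Metric.ball_mem_nhds p hδ] with y hy using heq hy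

/-! ### Jets of functions vanishing on a hypersurface -/

/-- A function vanishing on a smooth hypersurface is controlled by the defining function. -/
theorem isBigO_of_eq_zero_on_hypersurface {ρ u : ComplexSpace m → ℝ} {p : ComplexSpace m}
    (hρ : ContDiffAt ℝ 2 ρ p) (hρp : ρ p = 0) (hD : fderiv ℝ ρ p ≠ 0) (hu : ContDiffAt ℝ 2 u p)
    (hu0 : ∀ᶠ z in 𝓝 p, ρ z = 0 → u z = 0) : u =O[𝓝 p] ρ := by
  obtain ⟨a, ha⟩ : ∃ a, fderiv ℝ ρ p a = 1 := by
    obtain ⟨b, hb⟩ := DFunLike.ne_iff.1 hD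
    exact ⟨(fderiv ℝ ρ p b)⁻¹ • b, by simpa using inv_mul_cancel₀ hb⟩
  have ha0 : 0 < ‖a‖ := by
    rw [norm_pos_iff]
    rintro rfl
    simp at ha
  have h1 := isLittleO_iff.1 (hρ.hasStrictFDerivAt (by simp)).isLittleO
    (show 0 < (2 * ‖a‖)⁻¹ by positivity)
  obtain ⟨K, hK0, hK⟩ := (hu.hasStrictFDerivAt (by simp)).isBigO_sub.exists_pos
  have hcont : ∀ᶠ z in 𝓝 p, ContinuousAt ρ z := by
    filter_upwards [hρ.eventually (by simp)] with z hz using hz.continuousAt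
  have h2 := h1.and hK.bound
  obtain ⟨r₁, hr₁, hball₁⟩ := Metric.eventually_nhds_iff_ball.1 h2
  obtain ⟨r₂, hr₂, hball₂⟩ := Metric.eventually_nhds_iff_ball.1 (hcont.and hu0)
  set r := min r₁ r₂
  have hr : 0 < r := lt_min hr₁ hr₂
  have hpair : ∀ x ∈ Metric.ball p r, ∀ y ∈ Metric.ball p r,
      ‖ρ x - ρ y - fderiv ℝ ρ p (x - y)‖ ≤ (2 * ‖a‖)⁻¹ * ‖x - y‖ ∧
      ‖u x - u y‖ ≤ K * ‖x - y‖ := by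
    intro x hx y hy
    refine hball₁ (x, y) ?_
    rw [← ball_prod_same]
    exact ⟨Metric.ball_subset_ball (min_le_left _ _) hx,
      Metric.ball_subset_ball (min_le_left _ _) hy⟩
  refine IsBigO.of_bound (K * (2 * ‖a‖)) ?_
  have hsmall : ∀ᶠ z in 𝓝 p, 2 * |ρ z| * ‖a‖ < r / 2 := by
    have : Tendsto (fun z => 2 * |ρ z| * ‖a‖) (𝓝 p) (𝓝 0) := by
      simpa [ContinuousAt, hρp] using (hρ.continuousAt.abs.const_mul 2).mul_const ‖a‖
    exact this.eventually (gt_mem_nhds (half_pos hr))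
  filter_upwards [hsmall, Metric.ball_mem_nhds p (half_pos hr)] with z hz hzr
  have hzr' : z ∈ Metric.ball p r := Metric.ball_subset_ball (half_le_self hr.le) hzr
  have hline : ∀ s ∈ Set.Icc (-(2 * |ρ z|)) (2 * |ρ z|), z + s • a ∈ Metric.ball p r := by
    intro s hs
    have h3 : |s| * ‖a‖ ≤ 2 * |ρ z| * ‖a‖ := by
      gcongr
      exact abs_le.2 hs
    have h4 : dist (z + s • a) z = |s| * ‖a‖ := by
      rw [dist_eq_norm, add_sub_cancel_left, norm_smul, Real.norm_eq_abs]
    rw [Metric.mem_ball] at hzr ⊢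
    linarith [dist_triangle (z + s • a) z p]
  -- Along `a` the increment of `ρ` differs from `s` by at most `|s| / 2`, so a zero of `ρ` occurs
  -- with `|s| ≤ 2 |ρ z|`.
  have hest : ∀ s ∈ Set.Icc (-(2 * |ρ z|)) (2 * |ρ z|), |ρ (z + s • a) - ρ z - s| ≤ |s| / 2 := by
    intro s hs
    have h3 := (hpair _ (hline s hs) z hzr').1
    rw [add_sub_cancel_left, map_smul, ha, norm_smul, Real.norm_eq_abs, Real.norm_eq_abs,
      smul_eq_mul, mul_one] at h3
    refine h3.trans (le_of_eq ?_)
    field_simp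
  have hab : -(2 * |ρ z|) ≤ 2 * |ρ z| := by linarith [abs_nonneg (ρ z)]
  have hlow := (abs_le.1 (hest _ (Set.left_mem_Icc.2 hab))).2
  have hupp := (abs_le.1 (hest _ (Set.right_mem_Icc.2 hab))).1
  rw [abs_neg, abs_of_nonneg (by positivity : 0 ≤ 2 * |ρ z|)] at hlow
  rw [abs_of_nonneg (by positivity : 0 ≤ 2 * |ρ z|)] at hupp
  have hfc : ContinuousOn (fun s : ℝ => ρ (z + s • a)) (Set.Icc (-(2 * |ρ z|)) (2 * |ρ z|)) := by
    intro s hs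
    have hc := (hball₂ _ (Metric.ball_subset_ball (min_le_right _ _) (hline s hs))).1
    have hl : ContinuousAt (fun s : ℝ => z + s • a) s := by fun_prop
    exact (ContinuousAt.comp (f := fun s : ℝ => z + s • a) hc hl).continuousWithinAt
  obtain ⟨s, hs, hs0⟩ := intermediate_value_Icc hab hfc
    (show (0 : ℝ) ∈ _ from ⟨by linarith [le_abs_self (ρ z)], by linarith [neg_abs_le (ρ z)]⟩)
  have hus := (hball₂ _ (Metric.ball_subset_ball (min_le_right _ _) (hline s hs))).2 hs0
  have h3 := (hpair z hzr' _ (hline s hs)).2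
  rw [hus, sub_zero, sub_add_cancel_left, norm_neg, norm_smul, Real.norm_eq_abs s] at h3
  calc ‖u z‖ ≤ K * (|s| * ‖a‖) := h3
    _ ≤ K * ((2 * |ρ z|) * ‖a‖) := by
      gcongr
      exact abs_le.2 hs
    _ = K * (2 * ‖a‖) * ‖ρ z‖ := by rw [Real.norm_eq_abs]; ring

theorem eq_zero_of_isLittleO_sq {A B : ℝ} (h : (fun t : ℝ => t * A + t ^ 2 * B) =o[𝓝 0]
    fun t => t ^ 2) : A = 0 ∧ B = 0 := by
  have hne : ∀ n : ℕ, ∃ᶠ t : ℝ in 𝓝 0, t ^ n ≠ 0 := fun n => by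
    have h3 : ∀ᶠ s : ℝ in 𝓝[≠] 0, s ^ n ≠ 0 := by
      filter_upwards [self_mem_nhdsWithin] with s hs using pow_ne_zero n hs
    exact h3.frequently.filter_mono nhdsWithin_le_nhds
  have hsq : (fun t : ℝ => t ^ 2) =o[𝓝 0] fun t : ℝ => t ^ 1 := by
    exact isLittleO_pow_pow (by norm_num)
  have hA : A = 0 := by
    by_contra hA
    have h1 : (fun t : ℝ => t * A) =o[𝓝 0] fun t : ℝ => t ^ 1 := by
      have h2 := (h.trans hsq).sub
        (((isBigO_refl (fun t : ℝ => t ^ 2) (𝓝 0)).const_mul_left B).trans_isLittleO hsq)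
      exact h2.congr_left fun t => by ring
    have h3 : (fun t : ℝ => t ^ 1) =o[𝓝 0] fun t : ℝ => t ^ 1 :=
      ((isLittleO_const_mul_left_iff hA).1 (h1.congr_left fun t => by ring))
    exact isLittleO_irrefl (hne 1) h3
  refine ⟨hA, ?_⟩
  by_contra hB
  have h3 : (fun t : ℝ => t ^ 2) =o[𝓝 0] fun t : ℝ => t ^ 2 :=
    ((isLittleO_const_mul_left_iff hB).1 (h.congr_left fun t => by rw [hA]; ring))
  exact isLittleO_irrefl (hne 2) h3

theorem ContDiffAt.isLittleO_comp_parabola {f : ComplexSpace m → ℝ} {p : ComplexSpace m}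
    (hf : ContDiffAt ℝ 2 f p) (v w : ComplexSpace m) :
    (fun t : ℝ => f (p + (t • v + t ^ 2 • w)) - f p - (t * fderiv ℝ f p v
      + t ^ 2 * (fderiv ℝ f p w + 1 / 2 * fderiv ℝ (fderiv ℝ f) p v v)))
      =o[𝓝 0] fun t : ℝ => t ^ 2 := by
  have := hf.isLittleO_comp_expansion (l := 𝓝 (0 : ℝ)) (g := fun s => s) tendsto_id
      (x := fun t => t • v + t ^ 2 • w) (a := fun t => t • v) (b := fun t => t ^ 2 • w)
      (IsBigO.of_bound ‖v‖ (Eventually.of_forall fun s => by rw [norm_smul, mul_comm]))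
      (IsBigO.of_bound ‖w‖ (Eventually.of_forall fun s => by rw [norm_smul, mul_comm]))
      ((isLittleO_zero _ _).congr_left fun s => by simp)
  refine this.congr_left fun t => ?_
  simp only [map_smul, smul_apply, smul_eq_mul]
  ring

/-- If `u` vanishes on a hypersurface then its second order jet on the tangent space is proportional
to the jet of the defining function. -/
theorem exists_jet_proportional {ρ u : ComplexSpace m → ℝ} {p : ComplexSpace m}
    (hρ : ContDiffAt ℝ 2 ρ p) (hρp : ρ p = 0) (hD : fderiv ℝ ρ p ≠ 0) (hu : ContDiffAt ℝ 2 u p)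
    (hu0 : ∀ᶠ z in 𝓝 p, ρ z = 0 → u z = 0) :
    ∃ c : ℝ, fderiv ℝ u p = c • fderiv ℝ ρ p ∧ ∀ v, fderiv ℝ ρ p v = 0 →
      fderiv ℝ (fderiv ℝ u) p v v = c * fderiv ℝ (fderiv ℝ ρ) p v v := by
  have hO := isBigO_of_eq_zero_on_hypersurface hρ hρp hD hu hu0
  have hup : u p = 0 := hu0.self_of_nhds hρp
  obtain ⟨a, ha⟩ : ∃ a, fderiv ℝ ρ p a = 1 := by
    obtain ⟨b, hb⟩ := DFunLike.ne_iff.1 hD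
    exact ⟨(fderiv ℝ ρ p b)⁻¹ • b, by simpa using inv_mul_cancel₀ hb⟩
  have key : ∀ v, fderiv ℝ ρ p v = 0 → fderiv ℝ u p v = 0 ∧
      fderiv ℝ (fderiv ℝ u) p v v = fderiv ℝ u p a * fderiv ℝ (fderiv ℝ ρ) p v v := by
    intro v hv
    -- This bends the curve so that `ρ = o(t²)` along it; then `u = O(ρ)` makes both Taylor
    -- coefficients of `u` vanish.
    set w := (-(1 / 2) * fderiv ℝ (fderiv ℝ ρ) p v v) • a with hw
    have h1 := hρ.isLittleO_comp_parabola v w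
    have h2 := hu.isLittleO_comp_parabola v w
    have htr : Tendsto (fun t : ℝ => p + (t • v + t ^ 2 • w)) (𝓝 0) (𝓝 p) :=
      Continuous.tendsto' (by fun_prop) _ _ (by simp)
    have h3 : (fun t : ℝ => ρ (p + (t • v + t ^ 2 • w))) =o[𝓝 0] fun t : ℝ => t ^ 2 :=
      h1.congr_left fun t => by
        simp only [hρp, hv, hw, map_smul, ha, smul_eq_mul]; ring
    have h4 := (hO.comp_tendsto htr).trans_isLittleO h3
    have h5 := eq_zero_of_isLittleO_sq ((h4.sub h2).congr_left fun t => by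
      simp only [Function.comp, hup]; abel)
    refine ⟨h5.1, ?_⟩
    have h6 := h5.2
    simp only [hw, map_smul, smul_eq_mul] at h6
    linarith
  refine ⟨fderiv ℝ u p a, ?_, fun v hv => (key v hv).2⟩
  ext x
  have := (key (x - fderiv ℝ ρ p x • a) (by simp [ha])).1
  simp only [map_sub, map_smul, smul_eq_mul] at this
  simp only [smul_apply, smul_eq_mul]
  linarith

/-! ### Inverse mapping and conclusion -/

/-- A holomorphic mapping with injective differential at `p` is biholomorphic near `p`. -/
theorem exists_isBiholomorphicOn {φ : ComplexSpace m → ComplexSpace m} {p : ComplexSpace m}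
    {U : Set (ComplexSpace m)} (hU : IsOpen U) (hpU : p ∈ U) (hφ : AnalyticOnNhd ℂ φ U)
    (hinj : Function.Injective (fderiv ℂ φ p)) :
    ∃ V : Set (ComplexSpace m), IsOpen V ∧ p ∈ V ∧ V ⊆ U ∧ IsBiholomorphicOn φ V := by
  let e : ComplexSpace m ≃L[ℂ] ComplexSpace m :=
    (LinearEquiv.ofInjectiveEndo (fderiv ℂ φ p : ComplexSpace m →ₗ[ℂ] ComplexSpace m)
      hinj).toContinuousLinearEquiv
  have he : (e : ComplexSpace m →L[ℂ] ComplexSpace m) = fderiv ℂ φ p := by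
    ext x : 1
    rfl
  have hs : HasStrictFDerivAt φ (e : ComplexSpace m →L[ℂ] ComplexSpace m) p := by
    rw [he]; exact (hφ p hpU).hasStrictFDerivAt
  have hequiv : ∀ᶠ z in 𝓝 p, fderiv ℂ φ z ∈ Set.range
      (ContinuousLinearEquiv.toContinuousLinearMap (σ₁₂ := RingHom.id ℂ) (M₁ := ComplexSpace m)
        (M₂ := ComplexSpace m)) := by
    have hc : Tendsto (fderiv ℂ φ) (𝓝 p) (𝓝 (e : ComplexSpace m →L[ℂ] ComplexSpace m)) := by
      rw [he]; exact (hφ p hpU).fderiv.continuousAt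
    exact hc.eventually (ContinuousLinearEquiv.nhds e)
  set F := hs.toOpenPartialHomeomorph φ with hF
  have hFφ : (F : ComplexSpace m → ComplexSpace m) = φ := hs.toOpenPartialHomeomorph_coe
  obtain ⟨V, hV, hVo, hpV⟩ := eventually_nhds_iff.1 ((hequiv.and (hU.mem_nhds hpU)).and
    (F.open_source.mem_nhds hs.mem_toOpenPartialHomeomorph_source))
  have hVF : V ⊆ F.source := fun z hz => (hV z hz).2
  refine ⟨V, hVo, hpV, fun z hz => (hV z hz).1.2, hVo, ?_, fun z hz => hφ z (hV z hz).1.2, ?_,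
    F.symm, ?_, ?_⟩
  · rw [← hFφ]
    exact F.isOpen_image_of_subset_source hVo hVF
  · rw [← hFφ]
    exact F.injOn.mono hVF
  · rintro _ ⟨z, hz, rfl⟩
    obtain ⟨i, hi⟩ := (hV z hz).1.1
    have := F.analyticAt_symm' (hVF hz) (i := i) (by rw [hFφ]; exact hφ z (hV z hz).1.2)
      (by rw [hFφ]; exact hi.symm)
    rwa [hFφ] at this
  · intro z hz
    have := F.left_inv (hVF hz)
    rwa [hFφ] at this

theorem mainTheorem11 (n : ℕ) (hn : 1 ≤ n)
    (M M' : Set (ComplexSpace (n + 1)))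
    (hM : IsStronglyPseudoconvexAnalyticHypersurface M)
    (hM' : IsStronglyPseudoconvexAnalyticHypersurface M')
    (p : ComplexSpace (n + 1)) (hp : p ∈ M)
    (U : Set (ComplexSpace (n + 1))) (hU : IsOpen U) (hpU : p ∈ U)
    (φ : ComplexSpace (n + 1) → ComplexSpace (n + 1))
    (hφ : AnalyticOnNhd ℂ φ U)
    (hφM : ∀ z ∈ U ∩ M, φ z ∈ M') :
    ∃ V : Set (ComplexSpace (n + 1)), IsOpen V ∧ p ∈ V ∧ V ⊆ U ∧
      ((∃ c : ComplexSpace (n + 1), ∀ z ∈ V, φ z = c) ∨ IsBiholomorphicOn φ V) := by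
  obtain ⟨W, ρ, hpW, hρ, c, hc, hlevi⟩ := hM.exists_strictly_plurisubharmonic hp
  obtain ⟨W', ρ', hqW', hρ', c', hc', hlevi'⟩ :=
    hM'.exists_strictly_plurisubharmonic (hφM p ⟨hpU, hp⟩)
  set u : ComplexSpace (n + 1) → ℝ := fun z => ρ' (φ z) with hu
  have hφp := hφ p hpU
  have hnear : ∀ᶠ z in 𝓝 p, z ∈ U ∧ z ∈ W ∧ φ z ∈ W' :=
    (hU.mem_nhds hpU |> eventually_mem_set.2).and
      ((hρ.isOpen.mem_nhds hpW |> eventually_mem_set.2).and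
        (hφp.continuousAt.eventually (hρ'.isOpen.mem_nhds hqW')))
  have hua : ∀ {z}, z ∈ U → φ z ∈ W' → AnalyticAt ℝ u z := fun hz hz' =>
    (hρ'.analytic _ hz').comp (hφ _ hz).restrictScalars
  have hρM : ∀ {z}, z ∈ W → (z ∈ M ↔ ρ z = 0) := fun {z} hz => by
    have : z ∈ M ∩ W ↔ z ∈ W ∧ ρ z = 0 := by rw [hρ.inter_eq]; rfl
    exact ⟨fun h => (this.1 ⟨h, hz⟩).2, fun h => (this.2 ⟨hz, h⟩).1⟩
  have hρ'0 : ∀ {z}, z ∈ M' → z ∈ W' → ρ' z = 0 := fun {z} h hz => by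
    have : z ∈ M' ∩ W' ↔ z ∈ W' ∧ ρ' z = 0 := by rw [hρ'.inter_eq]; rfl
    exact (this.1 ⟨h, hz⟩).2
  have hρp : ρ p = 0 := (hρM hpW).1 hp
  have hup : u p = 0 := hρ'0 (hφM p ⟨hpU, hp⟩) hqW'
  have hρ2 : ContDiffAt ℝ 2 ρ p := (hρ.analytic p hpW).contDiffAt
  have hD := hρ.fderiv_ne_zero p hpW
  have hleviu : ∀ {z}, z ∈ U → φ z ∈ W' → ∀ ξ,
      leviForm u z ξ = leviForm ρ' (φ z) (fderiv ℂ φ z ξ) := fun hz hz' ξ =>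
    leviForm_comp (hφ _ hz) (hρ'.analytic _ hz').contDiffAt ξ
  have hpsh : ∀ {z}, z ∈ U → φ z ∈ W' → ∀ ξ, ∃ L, 0 ≤ L ∧ HasLeviAt u z ξ L := fun hz hz' ξ =>
    ⟨leviForm u _ ξ, by
      rw [hleviu hz hz']
      exact le_trans (by positivity) (hlevi' _ hz' _),
      hasLeviAt_leviForm (hua hz hz').contDiffAt ξ⟩
  have hu0 : ∀ᶠ z in 𝓝 p, ρ z = 0 → u z = 0 := by
    filter_upwards [hnear] with z hz h0
    exact hρ'0 (hφM z ⟨hz.1, (hρM hz.2.1).2 h0⟩) hz.2.2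
  have hside := eventually_nonpos_of_eq_zero_on_hypersurface (by omega) hρ2 hρp hc (hlevi p hpW)
    (u := u) (by
      filter_upwards [hnear, hu0] with z hz h0
      exact ⟨(hρ.analytic z hz.2.1).continuousAt, (hua hz.1 hz.2.2).continuousAt, h0,
        hpsh hz.1 hz.2.2⟩)
  rcases eventually_eq_zero_or_fderiv_ne_zero hρ2 hρp hD hup (by
    filter_upwards [hnear, hside] with z hz hs
    exact ⟨hua hz.1 hz.2.2, hs, hpsh hz.1 hz.2.2⟩) with hzero | hne
  · obtain ⟨r, hr, hball⟩ := Metric.eventually_nhds_iff_ball.1 (hzero.and hnear)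
    refine ⟨Metric.ball p r, Metric.isOpen_ball, Metric.mem_ball_self hr,
      fun z hz => (hball z hz).2.1, Or.inl ⟨φ p, fun z hz => ?_⟩⟩
    refine Metric.isOpen_ball.is_const_of_fderiv_eq_zero (𝕜 := ℂ) (convex_ball p r).isPreconnected
      (fun y hy => (hφ y (hball y hy).2.1).differentiableAt.differentiableWithinAt)
      (fun y hy => ?_) hz (Metric.mem_ball_self hr)
    ext1 ξ
    have hy0 : u =ᶠ[𝓝 y] fun _ => 0 := by
      filter_upwards [Metric.isOpen_ball.mem_nhds hy] with x hx using (hball x hx).1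
    have h1 : leviForm u y ξ = 0 := by
      have h2 : fderiv ℝ (fderiv ℝ u) y = 0 := by
        rw [hy0.fderiv.fderiv_eq]
        simp
      simp [leviForm, h2]
    have h3 := hlevi' _ (hball y hy).2.2.2 (fderiv ℂ φ y ξ)
    rw [← hleviu (hball y hy).2.1 (hball y hy).2.2.2, h1] at h3
    have h4 : ‖fderiv ℂ φ y ξ‖ ^ 2 ≤ 0 := by
      by_contra! h
      have := mul_pos hc' h
      linarith
    simpa using h4
  · have hinj : Function.Injective (fderiv ℂ φ p) := by
      rw [injective_iff_map_eq_zero]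
      intro v hv
      by_contra hv0
      obtain ⟨a, ha1, ha2⟩ := exists_jet_proportional hρ2 hρp hD
        (hua hpU hqW').contDiffAt hu0
      have ha0 : a ≠ 0 := by
        rintro rfl
        exact hne (by simpa using ha1)
      have hDu : ∀ w, fderiv ℂ φ p w = 0 → fderiv ℝ ρ p w = 0 := by
        intro w hw
        have h1 : HasFDerivAt u ((fderiv ℝ ρ' (φ p)).comp ((fderiv ℂ φ p).restrictScalars ℝ)) p :=
          (hρ'.analytic _ hqW').differentiableAt.hasFDerivAt.comp p
            (hφp.differentiableAt.hasFDerivAt.restrictScalars ℝ)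
        have h2 : fderiv ℝ u p w = 0 := by
          rw [h1.fderiv]
          simp [hw]
        rw [ha1] at h2
        simpa [ha0] using h2
      have hIv : fderiv ℂ φ p (Complex.I • v) = 0 := by rw [map_smul, hv, smul_zero]
      have h1 := hleviu hpU hqW' v
      have h2 : leviForm u p v = a * leviForm ρ p v := by
        rw [leviForm, leviForm, ha2 v (hDu v hv), ha2 _ (hDu _ hIv)]
        ring
      rw [h2, hv] at h1
      have h3 : leviForm ρ' (φ p) (0 : ComplexSpace (n + 1)) = 0 := by simp [leviForm]
      rw [h3] at h1
      have h4 : leviForm ρ p v = 0 := (mul_eq_zero.1 h1).resolve_left ha0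
      have h5 := hlevi p hpW v
      have : 0 < c * ‖v‖ ^ 2 := by
        have := norm_pos_iff.2 hv0
        positivity
      linarith
    obtain ⟨V, hVo, hpV, hVU, hV⟩ := exists_isBiholomorphicOn hU hpU hφ hinj
    exact ⟨V, hVo, hpV, hVU, Or.inr hV⟩
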